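/- Let $\Bbbk$ be a field. All algebras are over $\Bbbk$ and need not be unital. A \emph{$\mathrm{GD}^!$-algebra} is a vector space with two bilinear operations $*$ and $\star$ satisfying $$x*y=y*x,\qquad x*(y*z)=(x*y)*z,$$ $$(x\star y)\star z-x\star(y\star z)=(x\star z)\star y-x\star(z\star y),\qquad x\star(y\star z)=y\star(x\star z),$$ $$x\star(y*z)=(x\star y)*z,\qquad x\star(y*z)+y\star(x*z)=(x*y)\star z .$$ If $A$ is a commutative associative algebra with a derivation $d$, then $A^{(d)}$ denotes the space $A$ with the operations $a*b=ab$, $a\star b=d(a)b$. An algebra with two operations is called \emph{special} if it embeds into (is isomorphic to a subalgebra of) some $A^{(d)}$. 1. The class of all homomorphic images of special algebras coincides with the variety of $\mathrm{GD}^!$-algebras. 2. The defining identities of $\mathrm{GD}^!$ and their corollaries exhaust the identities of these operations: for every set $X$ and every non-associative polynomial $f$ over $\Bbbk$ in the operations $*,\star$ and the variables $X$, the identity $f=0$ holds on all algebras $A^{(d)}$ if and only if $f$ lies in the T-ideal generated by the identities above, and if and only if $f=0$ holds on all $\mathrm{GD}^!$-algebras. 3. For a set $X$ let $\mathrm{GD}^!\langle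 X\rangle$ be the free $\mathrm{GD}^!$-algebra and $\mathrm{ComDer}\langle X,d\rangle$ the free differential commutative associative algebra generated by $X$, i.e. the polynomials without constant term in the variables $d^s(x)$, $x\in X$, $s\ge 0$. Define the weight of a monomial by $\mathrm{wt}\big(d^{s_1}(x_1)\cdots d^{s_k}(x_k)\big)=\sum_{i=1}^k (s_i-1)$. Then the monomials of $\mathrm{ComDer}\langle X,d\rangle$ of weight $\le -1$ form a linear basis of $\mathrm{GD}^!\langle X\rangle$. That is, $\mathrm{GD}^!\langle X\rangle$ has a basis indexed by these monomials that the canonical homomorphism $\mathrm{GD}^!\langle X\rangle\to\mathrm{ComDer}\langle X,d\rangle$ ($x\mapsto x$, $f*g\mapsto fg$, $f\star g\mapsto d(f)g$) sends to the monomials themselves. -/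

import Mathlib

open Module

universe u v w t

/-- A (non-associative) algebra over `K` with underlying space `V` and two bilinear operations
`ast` (written `*` in the comments) and `star` (written `⋆`). No identities are assumed. -/
structure BiAlg (K : Type u) [Field K] (V : Type v) [AddCommGroup V] [Module K V] where
  ast : V →ₗ[K] V →ₗ[K] V
  star : V →ₗ[K] V →ₗ[K] V

namespace BiAlg

variable {K : Type u} [Field K] {V : Type v} [AddCommGroup V] [Module K V]
  {W : Type w} [AddCommGroup W] [Module K W]

/-- Homomorphisms of algebras with two operations. -/
def IsHom (B : BiAlg K V) (C : BiAlg K W) (f : V →ₗ[K] W) : Prop :=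
  (∀ x y, f (B.ast x y) = C.ast (f x) (f y)) ∧ (∀ x y, f (B.star x y) = C.star (f x) (f y))

/-- The variety of `GD^!`-algebras: `*` is commutative and associative, `⋆` is a right Novikov
product, and the two compatibility identities hold. -/
structure IsGDDual (B : BiAlg K V) : Prop where
  ast_comm : ∀ x y, B.ast x y = B.ast y x
  ast_assoc : ∀ x y z, B.ast x (B.ast y z) = B.ast (B.ast x y) z
  right_symm : ∀ x y z, B.star (B.star x y) z - B.star x (B.star y z) =
    B.star (B.star x z) y - B.star x (B.star z y)
  left_comm : ∀ x y z, B.star x (B.star y z) = B.star y (B.star x z)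
  star_ast : ∀ x y z, B.star x (B.ast y z) = B.ast (B.star x y) z
  ast_star : ∀ x y z, B.star x (B.ast y z) + B.star y (B.ast x z) = B.star (B.ast x y) z

/-- All values in `B` of the defining identities of `GD^!` (as left side minus right side). -/
inductive GDDualValue (B : BiAlg K V) : V → Prop
  | ast_comm (x y : V) : GDDualValue B (B.ast x y - B.ast y x)
  | ast_assoc (x y z : V) : GDDualValue B (B.ast x (B.ast y z) - B.ast (B.ast x y) z)
  | right_symm (x y z : V) : GDDualValue B
      ((B.star (B.star x y) z - B.star x (B.star y z)) -
        (B.star (B.star x z) y - B.star x (B.star z y)))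
  | left_comm (x y z : V) : GDDualValue B (B.star x (B.star y z) - B.star y (B.star x z))
  | star_ast (x y z : V) : GDDualValue B (B.star x (B.ast y z) - B.ast (B.star x y) z)
  | ast_star (x y z : V) : GDDualValue B
      ((B.star x (B.ast y z) + B.star y (B.ast x z)) - B.star (B.ast x y) z)

/-- Two-sided ideals with respect to both operations. -/
def IsIdeal (B : BiAlg K V) (I : Submodule K V) : Prop :=
  ∀ a, ∀ i ∈ I, B.ast a i ∈ I ∧ B.ast i a ∈ I ∧ B.star a i ∈ I ∧ B.star i a ∈ I

/-- The smallest ideal containing all values of the defining identities of `GD^!`. -/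
def gdIdeal (B : BiAlg K V) : Submodule K V :=
  sInf {I : Submodule K V | B.IsIdeal I ∧ ∀ r, B.GDDualValue r → r ∈ I}

theorem gdIdeal_isIdeal (B : BiAlg K V) : B.IsIdeal B.gdIdeal := by
  intro a i hi
  simp only [gdIdeal, Submodule.mem_sInf, Set.mem_ofPred_eq] at hi ⊢
  exact ⟨fun I hI => (hI.1 a i (hi I hI)).1, fun I hI => (hI.1 a i (hi I hI)).2.1,
    fun I hI => (hI.1 a i (hi I hI)).2.2.1, fun I hI => (hI.1 a i (hi I hI)).2.2.2⟩

theorem mem_gdIdeal_of_value (B : BiAlg K V) {r : V} (hr : B.GDDualValue r) : r ∈ B.gdIdeal := by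
  simp only [gdIdeal, Submodule.mem_sInf, Set.mem_ofPred_eq]
  exact fun I hI => hI.2 r hr

theorem gdIdeal_le (B : BiAlg K V) {I : Submodule K V} (hI : B.IsIdeal I)
    (h : ∀ r, B.GDDualValue r → r ∈ I) : B.gdIdeal ≤ I :=
  sInf_le ⟨hI, h⟩

/-- A homomorphism into a `GD^!`-algebra annihilates `gdIdeal`. -/
theorem gdIdeal_le_ker {B : BiAlg K V} {C : BiAlg K W} (hC : C.IsGDDual) {f : V →ₗ[K] W}
    (hf : B.IsHom C f) : B.gdIdeal ≤ LinearMap.ker f := by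
  obtain ⟨h1, h2⟩ := hf
  refine B.gdIdeal_le ?_ ?_
  · intro a i hi
    rw [LinearMap.mem_ker] at hi
    simp [LinearMap.mem_ker, h1, h2, hi]
  · intro r hr
    rw [LinearMap.mem_ker]
    cases hr with
    | ast_comm x y => simp only [map_sub, h1]; exact sub_eq_zero.2 (hC.ast_comm _ _)
    | ast_assoc x y z => simp only [map_sub, h1]; exact sub_eq_zero.2 (hC.ast_assoc _ _ _)
    | right_symm x y z => simp only [map_sub, h2]; exact sub_eq_zero.2 (hC.right_symm _ _ _)
    | left_comm x y z => simp only [map_sub, h2]; exact sub_eq_zero.2 (hC.left_comm _ _ _)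
    | star_ast x y z => simp only [map_sub, h1, h2]; exact sub_eq_zero.2 (hC.star_ast _ _ _)
    | ast_star x y z =>
      simp only [map_sub, map_add, h1, h2]; exact sub_eq_zero.2 (hC.ast_star _ _ _)

/-- The operation induced by a bilinear operation on the quotient by an ideal. -/
def quotOp (I : Submodule K V) (m : V →ₗ[K] V →ₗ[K] V)
    (h : ∀ a, ∀ i ∈ I, m a i ∈ I ∧ m i a ∈ I) : (V ⧸ I) →ₗ[K] (V ⧸ I) →ₗ[K] (V ⧸ I) :=
  I.liftQ
    { toFun := fun a => I.mapQ I (m a) fun i hi => (h a i hi).1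
      map_add' := by
        intro a b; ext x; simp
      map_smul' := by
        intro c a; ext x; simp }
    (by
      intro i hi
      rw [LinearMap.mem_ker]
      ext x
      simpa using (h x i hi).2)

@[simp] theorem quotOp_mk (I : Submodule K V) (m : V →ₗ[K] V →ₗ[K] V)
    (h : ∀ a, ∀ i ∈ I, m a i ∈ I ∧ m i a ∈ I) (a b : V) :
    quotOp I m h (I.mkQ a) (I.mkQ b) = I.mkQ (m a b) := rfl

/-- The quotient of an algebra with two operations by an ideal. -/
def quot (B : BiAlg K V) (I : Submodule K V) (hI : B.IsIdeal I) : BiAlg K (V ⧸ I) where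
  ast := quotOp I B.ast fun a i hi => ⟨(hI a i hi).1, (hI a i hi).2.1⟩
  star := quotOp I B.star fun a i hi => ⟨(hI a i hi).2.2.1, (hI a i hi).2.2.2⟩

end BiAlg

/-! ### Non-associative polynomials in two operations, and identities -/

/-- Non-associative words in the letters `X` and two binary operations. -/
inductive BiWord (X : Type w) : Type w
  | var (x : X) : BiWord X
  | ast (s r : BiWord X) : BiWord X
  | star (s r : BiWord X) : BiWord X

/-- Non-associative polynomials in two operations in the variables `X`. -/
abbrev BiPoly (K : Type u) [Field K] (X : Type w) : Type max w u := BiWord X →₀ K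

namespace BiPoly

variable (K : Type u) [Field K] (X : Type w)

/-- The free (magmatic) algebra with two operations. -/
noncomputable def alg : BiAlg K (BiPoly K X) where
  ast := Finsupp.linearCombination K fun s => Finsupp.lmapDomain K K (BiWord.ast s)
  star := Finsupp.linearCombination K fun s => Finsupp.lmapDomain K K (BiWord.star s)

/-- The T-ideal generated by the defining identities of `GD^!`: since the elements substituted for
the variables in the identities run over the whole free algebra, this is the ideal generated by all
substitution instances of the identities. -/
noncomputable def gdTIdeal : Submodule K (BiPoly K X) := (alg K X).gdIdeal

end BiPoly

section Eval

variable {K : Type u} [Field K] {X : Type w} {V : Type v} [AddCommGroup V] [Module K V]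

/-- The value of a word. -/
def BiWord.eval (B : BiAlg K V) (a : X → V) : BiWord X → V
  | .var x => a x
  | .ast s r => B.ast (s.eval B a) (r.eval B a)
  | .star s r => B.star (s.eval B a) (r.eval B a)

/-- The value of a polynomial. -/
noncomputable def BiPoly.eval (B : BiAlg K V) (a : X → V) : BiPoly K X →ₗ[K] V :=
  Finsupp.linearCombination K (BiWord.eval B a)

/-- The algebra `B` satisfies the identity `f = 0`. -/
def BiAlg.Satisfies (B : BiAlg K V) (f : BiPoly K X) : Prop :=
  ∀ a : X → V, BiPoly.eval B a f = 0

theorem BiPoly.eval_isHom (B : BiAlg K V) (a : X → V) :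
    (BiPoly.alg K X).IsHom B (BiPoly.eval B a) := by
  constructor
  · intro f g
    induction f using Finsupp.induction_linear with
    | zero => simp
    | add f₁ f₂ h₁ h₂ => simp [h₁, h₂]
    | single s c =>
      induction g using Finsupp.induction_linear with
      | zero => simp
      | add g₁ g₂ h₁ h₂ => simp only [map_add, h₁, h₂]
      | single r e =>
        simp [-Finsupp.single_mul, BiPoly.alg, BiPoly.eval, BiWord.eval, smul_comm e c, mul_smul]
  · intro f g
    induction f using Finsupp.induction_linear with
    | zero => simp
    | add f₁ f₂ h₁ h₂ => simp [h₁, h₂]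
    | single s c =>
      induction g using Finsupp.induction_linear with
      | zero => simp
      | add g₁ g₂ h₁ h₂ => simp only [map_add, h₁, h₂]
      | single r e =>
        simp [-Finsupp.single_mul, BiPoly.alg, BiPoly.eval, BiWord.eval, smul_comm e c, mul_smul]

end Eval

/-! ### The free `GD^!`-algebra -/

/-- The underlying space of the free `GD^!`-algebra generated by `X`. -/
abbrev FreeGDDual (K : Type u) [Field K] (X : Type w) : Type max w u :=
  BiPoly K X ⧸ BiPoly.gdTIdeal K X

namespace FreeGDDual

variable (K : Type u) [Field K] (X : Type w)

/-- The operations of the free `GD^!`-algebra. -/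
noncomputable def alg : BiAlg K (FreeGDDual K X) :=
  (BiPoly.alg K X).quot (BiPoly.gdTIdeal K X) (BiPoly.alg K X).gdIdeal_isIdeal

variable {X} in
/-- The free generators. -/
noncomputable def of (x : X) : FreeGDDual K X :=
  (BiPoly.gdTIdeal K X).mkQ (Finsupp.single (BiWord.var x) 1)

theorem alg_isGDDual : (alg K X).IsGDDual := by
  have key : ∀ p q : BiPoly K X, (BiPoly.alg K X).GDDualValue (p - q) →
      (BiPoly.gdTIdeal K X).mkQ p = (BiPoly.gdTIdeal K X).mkQ q := by
    intro p q h
    exact (Submodule.Quotient.eq _).2 ((BiPoly.alg K X).mem_gdIdeal_of_value h)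
  have surj := (BiPoly.gdTIdeal K X).mkQ_surjective
  constructor
  · intro x y
    obtain ⟨x, rfl⟩ := surj x
    obtain ⟨y, rfl⟩ := surj y
    exact key _ _ (.ast_comm x y)
  all_goals
    intro x y z
    obtain ⟨x, rfl⟩ := surj x
    obtain ⟨y, rfl⟩ := surj y
    obtain ⟨z, rfl⟩ := surj z
  · exact key _ _ (.ast_assoc x y z)
  · exact key _ _ (.right_symm x y z)
  · exact key _ _ (.left_comm x y z)
  · exact key _ _ (.star_ast x y z)
  · exact key _ _ (.ast_star x y z)

variable {K X} {V : Type v} [AddCommGroup V] [Module K V]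

/-- The homomorphism to a `GD^!`-algebra that extends a map of the generators. -/
noncomputable def lift (B : BiAlg K V) (hB : B.IsGDDual) (a : X → V) : FreeGDDual K X →ₗ[K] V :=
  (BiPoly.gdTIdeal K X).liftQ (BiPoly.eval B a)
    (BiAlg.gdIdeal_le_ker hB (BiPoly.eval_isHom B a))

theorem lift_of (B : BiAlg K V) (hB : B.IsGDDual) (a : X → V) (x : X) :
    lift B hB a (of K x) = a x := by
  simp [lift, of, BiPoly.eval, BiWord.eval]

theorem lift_isHom (B : BiAlg K V) (hB : B.IsGDDual) (a : X → V) :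
    (alg K X).IsHom B (lift B hB a) := by
  have surj := (BiPoly.gdTIdeal K X).mkQ_surjective
  constructor
  all_goals
    intro f g
    obtain ⟨f, rfl⟩ := surj f
    obtain ⟨g, rfl⟩ := surj g
  · exact (BiPoly.eval_isHom B a).1 f g
  · exact (BiPoly.eval_isHom B a).2 f g

/-- Homomorphisms from the free `GD^!`-algebra are determined by their values on generators. -/
theorem hom_ext (B : BiAlg K V) {f g : FreeGDDual K X →ₗ[K] V} (hf : (alg K X).IsHom B f)
    (hg : (alg K X).IsHom B g) (h : ∀ x, f (of K x) = g (of K x)) : f = g := by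
  have hast : ∀ s r : BiWord X, (BiPoly.gdTIdeal K X).mkQ (Finsupp.single (s.ast r) 1) =
      (alg K X).ast ((BiPoly.gdTIdeal K X).mkQ (Finsupp.single s 1))
        ((BiPoly.gdTIdeal K X).mkQ (Finsupp.single r 1)) := by
    intro s r
    simp [alg, BiAlg.quot, -Submodule.mkQ_apply, BiPoly.alg]
  have hstar : ∀ s r : BiWord X, (BiPoly.gdTIdeal K X).mkQ (Finsupp.single (s.star r) 1) =
      (alg K X).star ((BiPoly.gdTIdeal K X).mkQ (Finsupp.single s 1))
        ((BiPoly.gdTIdeal K X).mkQ (Finsupp.single r 1)) := by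
    intro s r
    simp [alg, BiAlg.quot, -Submodule.mkQ_apply, BiPoly.alg]
  refine Submodule.linearMap_qext _ (Finsupp.lhom_ext' fun s => LinearMap.ext_ring ?_)
  change f ((BiPoly.gdTIdeal K X).mkQ (Finsupp.single s 1)) =
    g ((BiPoly.gdTIdeal K X).mkQ (Finsupp.single s 1))
  induction s with
  | var x => exact h x
  | ast s r hs hr => rw [hast, hf.1, hg.1, hs, hr]
  | star s r hs hr => rw [hstar, hf.2, hg.2, hs, hr]

end FreeGDDual

/-! ### Differential commutative associative algebras (not necessarily unital) -/

section Differential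

variable {K : Type u} [Field K] {A : Type v} [NonUnitalCommRing A] [Module K A]
  [IsScalarTower K A A] [SMulCommClass K A A]

/-- The Leibniz rule. -/
def IsDer (d : A →ₗ[K] A) : Prop := ∀ a b, d (a * b) = d a * b + a * d b

/-- The algebra `(A, *, ⋆)` with `a * b = ab` and `a ⋆ b = d(a)b`. -/
def derAlg (d : A →ₗ[K] A) : BiAlg K A where
  ast := LinearMap.mul K A
  star := (LinearMap.mul K A).comp d

theorem derAlg_isGDDual {d : A →ₗ[K] A} (hd : IsDer d) : (derAlg d).IsGDDual := by
  have h : ∀ a b, d (a * b) = d a * b + a * d b := hd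
  constructor <;> intros <;> simp only [derAlg, LinearMap.mul_apply', LinearMap.comp_apply, h,
    add_mul]
  · exact mul_comm _ _
  · exact (mul_assoc _ _ _).symm
  · simp only [mul_assoc, add_sub_cancel_right]
    congr 1
    exact mul_comm _ _
  · exact mul_left_comm _ _ _
  · exact (mul_assoc _ _ _).symm
  · rename_i x y z
    rw [mul_assoc, mul_assoc, mul_left_comm x]

end Differential

/-- `B` is special: it embeds into `(A, ab, d(a)b)` for some commutative associative algebra `A`
with a derivation `d`. -/
def BiAlg.IsSpecial {K : Type u} [Field K] {V : Type v} [AddCommGroup V] [Module K V]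
    (B : BiAlg K V) : Prop :=
  ∃ (A : Type t) (_ : NonUnitalCommRing A) (_ : Module K A) (_ : IsScalarTower K A A)
    (_ : SMulCommClass K A A) (d : A →ₗ[K] A) (j : V →ₗ[K] A),
    IsDer d ∧ B.IsHom (derAlg d) j ∧ Function.Injective j

/-- `B` is a homomorphic image of a special algebra. -/
def BiAlg.IsImageOfSpecial {K : Type u} [Field K] {V : Type v} [AddCommGroup V] [Module K V]
    (B : BiAlg K V) : Prop :=
  ∃ (S : Type t) (_ : AddCommGroup S) (_ : Module K S) (C : BiAlg K S) (p : S →ₗ[K] V),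
    BiAlg.IsSpecial.{u, t, t} C ∧ C.IsHom B p ∧ Function.Surjective p

/-- `f = 0` is an identity of all algebras `(A, ab, d(a)b)`. -/
def BiPoly.IsDerIdentity {K : Type u} [Field K] {X : Type w} (f : BiPoly K X) : Prop :=
  ∀ (A : Type t) [NonUnitalCommRing A] [Module K A] [IsScalarTower K A A] [SMulCommClass K A A]
    (d : A →ₗ[K] A), IsDer d → (derAlg d).Satisfies f

/-- `f = 0` is an identity of all `GD^!`-algebras. -/
def BiPoly.IsGDDualIdentity {K : Type u} [Field K] {X : Type w} (f : BiPoly K X) : Prop :=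
  ∀ (V : Type t) [AddCommGroup V] [Module K V] (B : BiAlg K V), B.IsGDDual → B.Satisfies f

/-! ### The free differential commutative associative algebra -/

/-- The free (non-unital) commutative associative differential algebra generated by `X`:
the polynomials without constant term in the variables `d^s(x)`, which are indexed by `(x, s)`. -/
def ComDer (K : Type u) [Field K] (X : Type w) :
    NonUnitalSubalgebra K (MvPolynomial (X × ℕ) K) where
  carrier := {p | MvPolynomial.constantCoeff p = 0}
  add_mem' := by
    intro a b ha hb
    simp_all
  zero_mem' := by simp
  mul_mem' := by
    intro a b ha hb
    simp_all
  smul_mem' := by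
    intro c a ha
    simp_all [MvPolynomial.smul_eq_C_mul]

namespace ComDer

variable (K : Type u) [Field K] (X : Type w)

/-- The derivation of the polynomial algebra with `d(d^s(x)) = d^(s+1)(x)`. -/
noncomputable def polyD :
    Derivation K (MvPolynomial (X × ℕ) K) (MvPolynomial (X × ℕ) K) :=
  MvPolynomial.mkDerivation K fun i => MvPolynomial.X (i.1, i.2 + 1)

theorem polyD_mem (p : MvPolynomial (X × ℕ) K) : polyD K X p ∈ ComDer K X := by
  change MvPolynomial.constantCoeff (polyD K X p) = 0
  induction p using MvPolynomial.induction_on with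
  | C a => simp [polyD]
  | add p q hp hq => simp [hp, hq]
  | mul_X p i hp => simp [polyD, Derivation.leibniz]

/-- The derivation of `ComDer K X`. -/
noncomputable def d : ComDer K X →ₗ[K] ComDer K X where
  toFun p := ⟨polyD K X p.1, polyD_mem K X p.1⟩
  map_add' p q := Subtype.ext (map_add (polyD K X) p.1 q.1)
  map_smul' c p := Subtype.ext ((polyD K X).map_smul c p.1)

theorem d_isDer : IsDer (d K X) := by
  intro a b
  apply Subtype.ext
  change polyD K X (a.1 * b.1) = polyD K X a.1 * b.1 + a.1 * polyD K X b.1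
  rw [Derivation.leibniz, smul_eq_mul, smul_eq_mul]
  ring

variable {X} in
/-- The generators. -/
noncomputable def of (x : X) : ComDer K X :=
  ⟨MvPolynomial.X (x, 0), by change MvPolynomial.constantCoeff _ = 0; simp⟩

variable {X} in
/-- The weight of a monomial in the variables `d^s(x)`: each factor `d^s(x)` contributes
`s - 1`, so that `wt(x) = -1`, `wt(uv) = wt(u) + wt(v)`, and `d` raises the weight by `1`. -/
def wt (m : (X × ℕ) →₀ ℕ) : ℤ := m.sum fun i k => (k : ℤ) * ((i.2 : ℤ) - 1)

end ComDer

/-- The canonical homomorphism from the free `GD^!`-algebra to the free differential commutative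
algebra, `x ↦ x`, `f * g ↦ fg`, `f ⋆ g ↦ d(f)g`. -/
noncomputable def FreeGDDual.toComDer (K : Type u) [Field K] (X : Type w) :
    FreeGDDual K X →ₗ[K] ComDer K X :=
  FreeGDDual.lift (derAlg (ComDer.d K X)) (derAlg_isGDDual (ComDer.d_isDer K X)) (ComDer.of K)

/-! The heart of the matter is that the canonical map from the free `GD^!`-algebra to differential
polynomials is injective, with the monomials of weight ≤ -1 as a basis of its image.

The identities make all left multiplications commute. In `A^{(d)}`, multiplication by `d^(s+1)(x)
z_1 ⋯ z_s` can be written with `⋆` alone, recursively, by the Leibniz rule. The same recursion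
defines `derivOp` in any algebra; in a `GD^!`-algebra right symmetry makes it independent of the
order of the `z_i` (`derivOp_spec`).

A monomial of weight ≤ -1 has enough factors of order zero to hand `s` of them to each factor
`d^(s+1)(x)` and keep at least one. Applying the operators to the `*`-product of the remaining
letters gives the monomial a value. The value does not depend on the distribution, because letters
can be traded between operators (`MonVal.unique`). The span of the values is closed under both
operations (`span_monVal`), so they span the free algebra; each is sent to its own monomial
(`MonVal.map_eq`), so they are independent.

Hence the free algebra is special, and every `GD^!`-algebra is an image of a free one. An identity
of all `A^{(d)}` vanishes on the free generators, which means that it lies in the T-ideal. -/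

namespace BiAlg

variable {K : Type u} [Field K] {V : Type v} [AddCommGroup V] [Module K V]

/-! ### The commutative algebra of left multiplications. -/

/-- The associative algebra of operators generated by the left multiplications. -/
def multAlg (B : BiAlg K V) : Subalgebra K (Module.End K V) :=
  Algebra.adjoin K (Set.range B.ast ∪ Set.range B.star)

theorem ast_mem_multAlg (B : BiAlg K V) (v : V) : B.ast v ∈ B.multAlg :=
  Algebra.subset_adjoin (Or.inl ⟨v, rfl⟩)

theorem star_mem_multAlg (B : BiAlg K V) (v : V) : B.star v ∈ B.multAlg :=
  Algebra.subset_adjoin (Or.inr ⟨v, rfl⟩)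

/-- It suffices that generators commute: `*` with `*` by commutativity and associativity, `*` with
`⋆` by `star_ast` and commutativity, `⋆` with `⋆` by `left_comm`. -/
theorem IsGDDual.commute {B : BiAlg K V} (hB : B.IsGDDual) {S T : Module.End K V}
    (hS : S ∈ B.multAlg) (hT : T ∈ B.multAlg) (v : V) : S (T v) = T (S v) := by
  have key : ∀ a ∈ Set.range B.ast ∪ Set.range B.star,
      ∀ b ∈ Set.range B.ast ∪ Set.range B.star, Commute a b := by
    rintro _ (⟨x, rfl⟩ | ⟨x, rfl⟩) _ (⟨y, rfl⟩ | ⟨y, rfl⟩) <;> ext z <;>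
      simp only [Module.End.mul_apply]
    · rw [hB.ast_assoc, hB.ast_assoc, hB.ast_comm x y]
    · rw [hB.ast_comm x z, hB.star_ast, hB.ast_comm]
    · rw [hB.ast_comm y z, hB.star_ast, hB.ast_comm]
    · exact hB.left_comm _ _ _
  have h : Commute S T :=
    Algebra.commute_of_mem_adjoin_of_forall_mem_commute hT fun b hb =>
      (Algebra.commute_of_mem_adjoin_of_forall_mem_commute hS fun a ha => key b hb a ha).symm
  exact LinearMap.congr_fun h v

theorem IsGDDual.commute_ast {B : BiAlg K V} (hB : B.IsGDDual) {T : Module.End K V}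
    (hT : T ∈ B.multAlg) (v w : V) : T (B.ast v w) = B.ast v (T w) :=
  hB.commute hT (B.ast_mem_multAlg v) w

theorem IsGDDual.commute_star {B : BiAlg K V} (hB : B.IsGDDual) {T : Module.End K V}
    (hT : T ∈ B.multAlg) (v w : V) : T (B.star v w) = B.star v (T w) :=
  hB.commute hT (B.star_mem_multAlg v) w

/-- The right symmetry of `⋆` extends to all multiplication operators. -/
theorem IsGDDual.op_right_symm {B : BiAlg K V} (hB : B.IsGDDual) {T : Module.End K V}
    (hT : T ∈ B.multAlg) : ∀ y z : V, B.star (T y) z - T (B.star y z) =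
      B.star (T z) y - T (B.star z y) := by
  -- In `A^{(d)}`, for `T` the multiplication by `t`, both sides are `d(t)yz`. In the case `T =
  -- B.ast x` both sides reduce to `x ⋆ (y * z)`; the product case mirrors `d(st) = d(s)t + s d(t)`.
  induction hT using Algebra.adjoin_induction with
  | mem T hT =>
    rintro y z
    rcases hT with ⟨x, rfl⟩ | ⟨x, rfl⟩
    · rw [← hB.ast_star, ← hB.ast_star, hB.ast_comm z y, hB.ast_comm x (B.star y z),
        hB.ast_comm x (B.star z y), ← hB.star_ast, ← hB.star_ast, hB.ast_comm z x,
        hB.ast_comm y x]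
      abel
    · exact hB.right_symm x y z
  | algebraMap c =>
    intro y z
    simp [Module.algebraMap_end_apply]
  | add S T _ _ hS hT =>
    intro y z
    simp only [LinearMap.add_apply, map_add]
    have h1 := hS y z
    have h2 := hT y z
    linear_combination (norm := abel) h1 + h2
  | mul S T hS hT ihS ihT =>
    intro y z
    simp only [Module.End.mul_apply]
    have h1 := ihS (T y) z
    have h2 := ihS (T z) y
    have h3 := congrArg S (ihT y z)
    have h4 := congrArg T (ihS y z)
    simp only [map_sub] at h3 h4
    rw [← hB.commute_star hT, ← hB.commute_star hT] at h1 h2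
    rw [sub_eq_iff_eq_add] at h1 h2 h3 h4
    rw [h1, h2, h3, h4, hB.commute hS hT, hB.commute hS hT]
    abel

/-! ### Operators of multiplication by a higher derivative. -/

open scoped Classical in
/-- In `(A, ab, d(a)b)`, the multiplication by `d^(s+1)(x)` times the product of `Z`, where `Z` has
`s` elements. -/
noncomputable def derivOp (B : BiAlg K V) (x : V) : ℕ → Multiset V → Module.End K V
  | 0, _ => B.star x
  | s + 1, Y =>
    -- The Leibniz rule solved for its top term: differentiate `d^(s+1)(x)` times the product of
    -- `Y`, then subtract the terms where `d` hits a letter of `Y`. The intended case is `Y.card = s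
    -- + 1`; the 0 for empty `Y` is a default.
    if h : ∃ z, z ∈ Y then
      B.star (B.derivOp x s (Y.erase h.choose) h.choose) -
        (Y.map fun y => B.star y * B.derivOp x s (Y.erase y)).sum
    else 0

theorem derivOp_mem (B : BiAlg K V) (x : V) (s : ℕ) (Y : Multiset V) :
    B.derivOp x s Y ∈ B.multAlg := by
  induction s generalizing Y with
  | zero => exact B.star_mem_multAlg x
  | succ s ih =>
    rw [derivOp]
    split_ifs with h
    · refine sub_mem (B.star_mem_multAlg _) (multiset_sum_mem _ ?_)
      intro T hT
      obtain ⟨y, -, rfl⟩ := Multiset.mem_map.1 hT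
      exact mul_mem (B.star_mem_multAlg _) (ih _)
    · exact zero_mem _

-- The two claims feed each other: symmetry at level `s` allows any letter as head in the recursion
-- for `s + 1`, and that recursion with `op_right_symm` gives symmetry at level `s + 1`.
open scoped Classical in
theorem IsGDDual.derivOp_spec {B : BiAlg K V} (hB : B.IsGDDual) (x : V) (s : ℕ) :
    (∀ Y : Multiset V, Y.card = s + 1 → ∀ z ∈ Y, ∀ z' ∈ Y,
      B.derivOp x s (Y.erase z) z = B.derivOp x s (Y.erase z') z') ∧
    (∀ (y : V) (Z : Multiset V), Z.card = s → B.derivOp x (s + 1) (y ::ₘ Z) =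
      B.star (B.derivOp x s Z y) - B.star y * B.derivOp x s Z -
        (Z.map fun u => B.star u * B.derivOp x s (y ::ₘ Z.erase u)).sum) := by
  have step : ∀ s, (∀ Y : Multiset V, Y.card = s + 1 → ∀ z ∈ Y, ∀ z' ∈ Y,
      B.derivOp x s (Y.erase z) z = B.derivOp x s (Y.erase z') z') →
      (∀ (y : V) (Z : Multiset V), Z.card = s → B.derivOp x (s + 1) (y ::ₘ Z) =
      B.star (B.derivOp x s Z y) - B.star y * B.derivOp x s Z -
        (Z.map fun u => B.star u * B.derivOp x s (y ::ₘ Z.erase u)).sum) := by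
    intro s hs y Z hZ
    have h : ∃ z, z ∈ y ::ₘ Z := ⟨y, Multiset.mem_cons_self _ _⟩
    rw [derivOp, dif_pos h, hs (y ::ₘ Z) (by simp [hZ]) _ h.choose_spec y
      (Multiset.mem_cons_self _ _), Multiset.map_cons, Multiset.sum_cons,
      Multiset.erase_cons_head, ← sub_sub]
    congr 2
    refine Multiset.map_congr rfl fun u hu => ?_
    rw [Multiset.erase_cons_tail_of_mem hu]
  have main : ∀ Y : Multiset V, Y.card = s + 1 → ∀ z ∈ Y, ∀ z' ∈ Y,
      B.derivOp x s (Y.erase z) z = B.derivOp x s (Y.erase z') z' := by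
    induction s with
    | zero =>
      intro Y hY z hz z' hz'
      obtain ⟨a, rfl⟩ := Multiset.card_eq_one.1 hY
      rw [Multiset.mem_singleton] at hz hz'
      rw [hz, hz']
    | succ s ih =>
      intro Y hY z hz z' hz'
      by_cases hne : z = z'
      · rw [hne]
      obtain ⟨Y, rfl⟩ := Multiset.exists_cons_of_mem hz
      have hz'Y : z' ∈ Y := (Multiset.mem_cons.1 hz').resolve_left (Ne.symm hne)
      obtain ⟨Z, rfl⟩ := Multiset.exists_cons_of_mem hz'Y
      rw [Multiset.erase_cons_head, Multiset.cons_swap z z', Multiset.erase_cons_head]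
      have hZ : Z.card = s := by simpa using hY
      rw [step s ih _ _ hZ, step s ih _ _ hZ]
      simp only [LinearMap.sub_apply, Module.End.mul_apply]
      -- The first two terms are exchanged by `op_right_symm`; the sums then agree term by term by
      -- the induction hypothesis.
      rw [← hB.commute_star (B.derivOp_mem x s Z), ← hB.commute_star (B.derivOp_mem x s Z),
        hB.op_right_symm (B.derivOp_mem x s Z)]
      congr 1
      have hsum : ∀ a b : V, (Z.map fun u => B.star u * B.derivOp x s (a ::ₘ Z.erase u)).sum b =
          (Z.map fun u => B.star u (B.derivOp x s (a ::ₘ Z.erase u) b)).sum := by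
        intro a b
        rw [← LinearMap.applyₗ_apply_apply (R := K), map_multiset_sum, Multiset.map_map]
        rfl
      rw [hsum, hsum]
      congr 1
      refine Multiset.map_congr rfl fun u hu => ?_
      congr 1
      have h := ih (z ::ₘ z' ::ₘ Z.erase u)
        (by rw [Multiset.card_cons, Multiset.card_cons, Multiset.card_erase_add_one hu, hZ])
        z (by simp) z' (by simp)
      rw [Multiset.erase_cons_head, Multiset.cons_swap, Multiset.erase_cons_head] at h
      exact h
  exact ⟨main, step s main⟩

open scoped Classical in
theorem IsGDDual.derivOp_succ {B : BiAlg K V} (hB : B.IsGDDual) (x y : V) {Z : Multiset V}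
    {s : ℕ} (hZ : Z.card = s) : B.derivOp x (s + 1) (y ::ₘ Z) =
      B.star (B.derivOp x s Z y) - B.star y * B.derivOp x s Z -
        (Z.map fun u => B.star u * B.derivOp x s (y ::ₘ Z.erase u)).sum :=
  (hB.derivOp_spec x s).2 y Z hZ

/-- The argument and the letters of the multiset together are `s + 1` interchangeable factors. -/
theorem IsGDDual.derivOp_swap {B : BiAlg K V} (hB : B.IsGDDual) (x y z : V) {Z : Multiset V}
    {s : ℕ} (hZ : Z.card + 1 = s) : B.derivOp x s (y ::ₘ Z) z = B.derivOp x s (z ::ₘ Z) y := by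
  classical
  have h := (hB.derivOp_spec x s).1 (z ::ₘ y ::ₘ Z) (by simp [hZ]) z (by simp) y (by simp)
  rwa [Multiset.erase_cons_head, Multiset.cons_swap, Multiset.erase_cons_head] at h

/-- The operators `derivOp` are linear over `multAlg` in the elements of the multiset. -/
theorem IsGDDual.derivOp_apply_cons {B : BiAlg K V} (hB : B.IsGDDual) (x y : V) {Z : Multiset V}
    {s : ℕ} (hZ : Z.card + 1 = s) {T : Module.End K V} (hT : T ∈ B.multAlg) :
    B.derivOp x s (T y ::ₘ Z) = T * B.derivOp x s (y ::ₘ Z) := by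
  ext w
  rw [Module.End.mul_apply, hB.derivOp_swap x _ _ hZ, hB.derivOp_swap x y w hZ,
    hB.commute hT (B.derivOp_mem _ _ _)]

end BiAlg

/-! ### Values of differential monomials: exchange, uniqueness, existence, closure. -/

namespace BiAlg

variable {K : Type u} [Field K] {V : Type v} [AddCommGroup V] [Module K V]

/-- `B.MonVal S D Y v` says that `v` is a value, in terms of the operations of `B`, of the
differential monomial with factors `d^(s+1)(x)` for `(x, s) ∈ D` and `y` for `y ∈ Y`, where all the
letters belong to `S`. -/
inductive MonVal (B : BiAlg K V) (S : Set V) : Multiset (V × ℕ) → Multiset V → V → Prop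
  | letter {y : V} (hy : y ∈ S) : MonVal B S 0 {y} y
  | mul {D : Multiset (V × ℕ)} {Y : Multiset V} {y v : V} (hy : y ∈ S) (h : MonVal B S D Y v) :
      MonVal B S D (y ::ₘ Y) (B.ast y v)
  | op {D : Multiset (V × ℕ)} {Y Z : Multiset V} {x v : V} {s : ℕ} (hx : x ∈ S)
      (hZ : ∀ z ∈ Z, z ∈ S) (hs : Z.card = s) (h : MonVal B S D Y v) :
      MonVal B S ((x, s) ::ₘ D) (Z + Y) (B.derivOp x s Z v)

/-- The algebra generated by the operators that build up monomials in the letters from `S`. -/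
def letterAlg (B : BiAlg K V) (S : Set V) : Subalgebra K (Module.End K V) :=
  Algebra.adjoin K ({T | ∃ y ∈ S, T = B.ast y} ∪
    {T | ∃ x ∈ S, ∃ Z : Multiset V, (∀ z ∈ Z, z ∈ S) ∧ T = B.derivOp x Z.card Z})

theorem ast_mem_letterAlg (B : BiAlg K V) {S : Set V} {y : V} (hy : y ∈ S) :
    B.ast y ∈ B.letterAlg S :=
  Algebra.subset_adjoin (Or.inl ⟨y, hy, rfl⟩)

theorem derivOp_mem_letterAlg (B : BiAlg K V) {S : Set V} {x : V} (hx : x ∈ S) {Z : Multiset V}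
    {s : ℕ} (hZ : ∀ z ∈ Z, z ∈ S) (hs : Z.card = s) : B.derivOp x s Z ∈ B.letterAlg S :=
  Algebra.subset_adjoin (Or.inr ⟨x, hx, Z, hZ, by rw [hs]⟩)

theorem letterAlg_le_multAlg (B : BiAlg K V) (S : Set V) : B.letterAlg S ≤ B.multAlg := by
  refine Algebra.adjoin_le ?_
  rintro _ (⟨y, -, rfl⟩ | ⟨x, -, Z, -, rfl⟩)
  · exact B.ast_mem_multAlg y
  · exact B.derivOp_mem _ _ _

namespace MonVal

variable {B : BiAlg K V} {S : Set V} {D D' : Multiset (V × ℕ)} {Y Y' : Multiset V} {v v' : V}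

theorem exists_mem (h : B.MonVal S D Y v) : ∃ y, y ∈ Y ∧ y ∈ S := by
  induction h with
  | letter hy => exact ⟨_, Multiset.mem_singleton_self _, hy⟩
  | mul hy => exact ⟨_, Multiset.mem_cons_self _ _, hy⟩
  | op hx hZ hs h ih =>
    obtain ⟨y, hy, hyS⟩ := ih
    exact ⟨y, Multiset.mem_add.2 (Or.inr hy), hyS⟩

theorem mem_of_mem (h : B.MonVal S D Y v) : ∀ y ∈ Y, y ∈ S := by
  induction h with
  | letter hy => intro z hz; rwa [Multiset.mem_singleton.1 hz]
  | mul hy h ih =>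
    intro z hz
    rcases Multiset.mem_cons.1 hz with rfl | hz
    exacts [hy, ih z hz]
  | op hx hZ hs h ih =>
    intro z hz
    rcases Multiset.mem_add.1 hz with hz | hz
    exacts [hZ z hz, ih z hz]

/-- The `*`-product with a value stays a monomial operator. -/
theorem ast_mem (hB : B.IsGDDual) (h : B.MonVal S D Y v) : B.ast v ∈ B.letterAlg S := by
  induction h with
  | letter hy => exact B.ast_mem_letterAlg hy
  | @mul D Y y v hy h ih =>
    have : B.ast (B.ast y v) = B.ast y * B.ast v := by
      ext z; exact (hB.ast_assoc _ _ _).symm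
    rw [this]
    exact mul_mem (B.ast_mem_letterAlg hy) ih
  | @op D Y Z x v s hx hZ hs h ih =>
    have : B.ast (B.derivOp x s Z v) = B.derivOp x s Z * B.ast v := by
      ext z
      rw [hB.ast_comm, ← hB.commute_ast (B.derivOp_mem _ _ _), hB.ast_comm, Module.End.mul_apply]
    rw [this]
    exact mul_mem (B.derivOp_mem_letterAlg hx hZ hs) ih

/-- A value depends linearly on any chosen letter of order zero, which may be replaced. -/
theorem exchange (hB : B.IsGDDual) (h : B.MonVal S D Y v) {y : V} {W : Multiset V}
    (hY : Y = y ::ₘ W) : ∃ T ∈ B.letterAlg S, v = T y ∧ ∀ z ∈ S, B.MonVal S D (z ::ₘ W) (T z) := by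
  induction h generalizing y W with
  | letter hy =>
    obtain ⟨rfl, rfl⟩ := Multiset.singleton_eq_cons_iff _ |>.1 hY
    exact ⟨1, one_mem _, rfl, fun z hz => .letter hz⟩
  | @mul D Y y₁ v hy h ih =>
    by_cases hne : y = y₁
    · subst hne
      obtain rfl := (Multiset.cons_inj_right _).1 hY
      refine ⟨B.ast v, h.ast_mem hB, hB.ast_comm _ _, fun z hz => ?_⟩
      rw [hB.ast_comm]
      exact .mul hz h
    · have hyY : y ∈ Y := by
        have : y ∈ y₁ ::ₘ Y := hY ▸ Multiset.mem_cons_self _ _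
        exact (Multiset.mem_cons.1 this).resolve_left hne
      obtain ⟨Y, rfl⟩ := Multiset.exists_cons_of_mem hyY
      rw [Multiset.cons_swap] at hY
      obtain rfl := (Multiset.cons_inj_right _).1 hY
      obtain ⟨T, hT, rfl, hT'⟩ := ih rfl
      refine ⟨B.ast y₁ * T, mul_mem (B.ast_mem_letterAlg hy) hT, rfl, fun z hz => ?_⟩
      rw [Multiset.cons_swap]
      exact .mul hy (hT' z hz)
  | @op D Y Z x v s hx hZ hs h ih =>
    have hy : y ∈ Z + Y := hY ▸ Multiset.mem_cons_self _ _
    rcases Multiset.mem_add.1 hy with hy | hy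
    · obtain ⟨Z, rfl⟩ := Multiset.exists_cons_of_mem hy
      rw [Multiset.cons_add] at hY
      obtain rfl := (Multiset.cons_inj_right _).1 hY
      have hs' : Z.card + 1 = s := by simpa using hs
      -- Swapping `y` with `v` puts `v`, which need not be a letter, into the multiset. Writing `v =
      -- T y₀` with a letter `y₀` and pulling `T` out keeps the operator in `letterAlg`.
      refine ⟨B.derivOp x s (v ::ₘ Z), ?_, hB.derivOp_swap _ _ _ hs', fun z hz => ?_⟩
      · obtain ⟨y₀, hy₀, hy₀S⟩ := h.exists_mem
        obtain ⟨Y, rfl⟩ := Multiset.exists_cons_of_mem hy₀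
        obtain ⟨T, hT, rfl, -⟩ := ih rfl
        rw [hB.derivOp_apply_cons x y₀ hs' (B.letterAlg_le_multAlg S hT)]
        refine mul_mem hT (B.derivOp_mem_letterAlg hx ?_ (by simpa using hs'))
        intro z hz
        rcases Multiset.mem_cons.1 hz with rfl | hz
        exacts [hy₀S, hZ z (Multiset.mem_cons_of_mem hz)]
      · rw [hB.derivOp_swap x v z hs', ← Multiset.cons_add]
        refine .op hx ?_ (by simpa using hs') h
        intro u hu
        rcases Multiset.mem_cons.1 hu with rfl | hu
        exacts [hz, hZ u (Multiset.mem_cons_of_mem hu)]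
    · obtain ⟨Y, rfl⟩ := Multiset.exists_cons_of_mem hy
      rw [Multiset.add_cons] at hY
      obtain rfl := (Multiset.cons_inj_right _).1 hY
      obtain ⟨T, hT, rfl, hT'⟩ := ih rfl
      refine ⟨B.derivOp x s Z * T, mul_mem (B.derivOp_mem_letterAlg hx hZ hs) hT, rfl,
        fun z hz => ?_⟩
      rw [← Multiset.add_cons]
      exact .op hx hZ hs (hT' z hz)

/-- Operators commute, so the one belonging to any chosen derivative can be made outermost. -/
theorem exists_op (hB : B.IsGDDual) (h : B.MonVal S D Y v) {x : V} {s : ℕ}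
    (hD : D = (x, s) ::ₘ D') : ∃ Z W v₀, Z.card = s ∧ Y = Z + W ∧ B.MonVal S D' W v₀ ∧
      v = B.derivOp x s Z v₀ := by
  induction h generalizing D' with
  | letter hy => exact absurd hD.symm (Multiset.cons_ne_zero)
  | @mul D Y y v hy h ih =>
    obtain ⟨Z, W, v₀, hs, rfl, h₀, rfl⟩ := ih hD
    refine ⟨Z, y ::ₘ W, B.ast y v₀, hs, (Multiset.add_cons _ _ _).symm, .mul hy h₀, ?_⟩
    rw [hB.commute_ast (B.derivOp_mem _ _ _)]
  | @op D Y Z x₁ v s₁ hx hZ hs h ih =>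
    by_cases hne : (x, s) = (x₁, s₁)
    · obtain ⟨rfl, rfl⟩ := Prod.mk.inj hne
      obtain rfl := (Multiset.cons_inj_right _).1 hD
      exact ⟨Z, Y, v, hs, rfl, h, rfl⟩
    · have hmem : (x, s) ∈ D := by
        have : (x, s) ∈ (x₁, s₁) ::ₘ D := hD ▸ Multiset.mem_cons_self _ _
        exact (Multiset.mem_cons.1 this).resolve_left hne
      obtain ⟨D, rfl⟩ := Multiset.exists_cons_of_mem hmem
      rw [Multiset.cons_swap] at hD
      obtain rfl := (Multiset.cons_inj_right _).1 hD
      obtain ⟨Z₁, W, v₀, hs', rfl, h₀, rfl⟩ := ih rfl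
      refine ⟨Z₁, Z + W, B.derivOp x₁ s₁ Z v₀, hs', by rw [add_left_comm], .op hx hZ hs h₀, ?_⟩
      exact hB.commute (B.derivOp_mem _ _ _) (B.derivOp_mem _ _ _) _

/-- The letters fed to the outermost operator are converted one at a time: `C` holds those already
matched, `n` counts those still to match. -/
theorem exists_change (hB : B.IsGDDual) (x : V) {s n : ℕ} {C Z Z' : Multiset V}
    (hs : C.card + n = s) (hZ : Z.card = n) (hZ' : Z'.card = n) (h : B.MonVal S D Y v)
    (hY : Z + Y = Z' + Y') (hS : ∀ z ∈ Z, z ∈ S) :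
    ∃ v', B.MonVal S D Y' v' ∧ B.derivOp x s (C + Z) v = B.derivOp x s (C + Z') v' := by
  induction n generalizing C Z Z' Y v with
  | zero =>
    rw [Multiset.card_eq_zero] at hZ hZ'
    subst hZ hZ'
    simp only [zero_add] at hY
    exact ⟨v, hY ▸ h, rfl⟩
  | succ n ih =>
    obtain ⟨z, Z', rfl⟩ : ∃ z Z'', Z' = z ::ₘ Z'' := by
      obtain ⟨z, hz⟩ := Multiset.card_pos_iff_exists_mem.1 (by omega : 0 < Z'.card)
      exact ⟨z, Multiset.exists_cons_of_mem hz⟩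
    have hZ'' : Z'.card = n := by simpa using hZ'
    have key : ∀ {Z Y : Multiset V} {v : V}, Z.card = n → B.MonVal S D Y v →
        (z ::ₘ Z) + Y = z ::ₘ Z' + Y' → (∀ u ∈ Z, u ∈ S) → ∃ v', B.MonVal S D Y' v' ∧
          B.derivOp x s (C + z ::ₘ Z) v = B.derivOp x s (C + z ::ₘ Z') v' := by
      intro Z Y v hZ h hY hS
      rw [Multiset.cons_add, Multiset.cons_add] at hY
      have := ih (C := z ::ₘ C) (by rw [Multiset.card_cons]; omega) hZ hZ'' h
        ((Multiset.cons_inj_right _).1 hY) hS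
      simpa only [Multiset.add_cons, Multiset.cons_add] using this
    have hz : z ∈ Z + Y := by rw [hY, Multiset.cons_add]; exact Multiset.mem_cons_self _ _
    by_cases hzZ : z ∈ Z
    · obtain ⟨Z, rfl⟩ := Multiset.exists_cons_of_mem hzZ
      exact key (by simpa using hZ) h hY fun u hu => hS u (Multiset.mem_cons_of_mem hu)
    -- The wanted letter `z` sits inside `v = T z`; it is traded for some `w ∈ Z`, since `T`
    -- commutes with the operator and `derivOp_swap` interchanges `w` and `z`.
    · have hzY := (Multiset.mem_add.1 hz).resolve_left hzZ
      obtain ⟨Y, rfl⟩ := Multiset.exists_cons_of_mem hzY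
      obtain ⟨w, hw⟩ := Multiset.card_pos_iff_exists_mem.1 (by omega : 0 < Z.card)
      obtain ⟨Z, rfl⟩ := Multiset.exists_cons_of_mem hw
      obtain ⟨T, hT, rfl, hT'⟩ := h.exchange hB rfl
      have hTm := B.letterAlg_le_multAlg S hT
      have hZn : Z.card = n := by simpa using hZ
      have e : B.derivOp x s (C + w ::ₘ Z) (T z) = B.derivOp x s (C + z ::ₘ Z) (T w) := by
        rw [hB.commute (B.derivOp_mem _ _ _) hTm, hB.commute (B.derivOp_mem _ _ _) hTm,
          Multiset.add_cons, Multiset.add_cons,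
          hB.derivOp_swap x w z (by rw [Multiset.card_add]; omega)]
      rw [e]
      refine key hZn (hT' w (hS w hw)) ?_ fun u hu => hS u (Multiset.mem_cons_of_mem hu)
      rw [← hY]
      simp only [Multiset.add_cons, Multiset.cons_add, Multiset.cons_swap]

/-- The counterpart of `exists_op` when only letters of order zero remain; `W ≠ 0` excludes a bare
letter. -/
theorem exists_mul (hB : B.IsGDDual) (h : B.MonVal S D Y v) {y : V} {W : Multiset V}
    (hD : D = 0) (hY : Y = y ::ₘ W) (hW : W ≠ 0) :
    ∃ v₀, B.MonVal S 0 W v₀ ∧ v = B.ast y v₀ := by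
  cases h with
  | letter hy => exact absurd (Multiset.singleton_eq_cons_iff _ |>.1 hY).2 hW
  | @mul D Y y₁ v hy h =>
    subst hD
    by_cases hne : y = y₁
    · subst hne
      obtain rfl := (Multiset.cons_inj_right _).1 hY
      exact ⟨v, h, rfl⟩
    · have hyY : y ∈ Y := by
        have : y ∈ y₁ ::ₘ Y := hY ▸ Multiset.mem_cons_self _ _
        exact (Multiset.mem_cons.1 this).resolve_left hne
      obtain ⟨Y, rfl⟩ := Multiset.exists_cons_of_mem hyY
      rw [Multiset.cons_swap] at hY
      obtain rfl := (Multiset.cons_inj_right _).1 hY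
      obtain ⟨T, hT, rfl, hT'⟩ := h.exchange hB rfl
      have hTm := B.letterAlg_le_multAlg S hT
      refine ⟨T y₁, hT' y₁ hy, ?_⟩
      rw [← hB.commute_ast hTm, ← hB.commute_ast hTm, hB.ast_comm]
  | op => exact absurd hD (Multiset.cons_ne_zero)

/-- Induction on `D`: both values get the same outermost operator by `exists_op` and the same
letters in it by `exists_change`, and then the inner values are compared. For `D = 0`, `exists_mul`
peels off a common letter. -/
theorem unique (hB : B.IsGDDual) (h : B.MonVal S D Y v) (h' : B.MonVal S D Y v') : v = v' := by
  induction D using Multiset.induction_on generalizing Y v v' with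
  | empty =>
    induction Y using Multiset.induction_on generalizing v v' with
    | empty => obtain ⟨y, hy, -⟩ := h.exists_mem; simp at hy
    | cons y W ih =>
      by_cases hW : W = 0
      · subst hW
        have single : ∀ {v}, B.MonVal S 0 (y ::ₘ 0) v → v = y := by
          intro v h
          generalize hD : (0 : Multiset (V × ℕ)) = D at h
          generalize hY : y ::ₘ (0 : Multiset V) = Y at h
          cases h with
          | letter => exact (Multiset.singleton_inj.1 hY).symm
          | mul hy h =>
            obtain ⟨z, hz, -⟩ := h.exists_mem
            have hc := congrArg Multiset.card hY
            have := Multiset.card_pos_iff_exists_mem.2 ⟨z, hz⟩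
            simp only [Multiset.card_cons, Multiset.card_zero] at hc
            omega
          | op => exact absurd hD.symm (Multiset.cons_ne_zero)
        rw [single h, single h']
      · obtain ⟨v₀, h₀, rfl⟩ := h.exists_mul hB rfl rfl hW
        obtain ⟨v₁, h₁, rfl⟩ := h'.exists_mul hB rfl rfl hW
        rw [ih h₀ h₁]
  | cons p D ih =>
    obtain ⟨x, s⟩ := p
    have hS := h.mem_of_mem
    obtain ⟨Z, W, v₀, hs, rfl, h₀, rfl⟩ := h.exists_op hB rfl
    obtain ⟨Z', W', v₁, hs', hZW, h₁, rfl⟩ := h'.exists_op hB rfl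
    obtain ⟨v₂, h₂, e⟩ := h₀.exists_change hB x (s := s) (C := 0) (by simp) hs hs' hZW
      fun z hz => hS z (Multiset.mem_add.2 (Or.inl hz))
    simp only [zero_add] at e
    rw [e, ih h₂ h₁]

theorem exists_val (B : BiAlg K V) {S : Set V} (D : Multiset (V × ℕ)) (hD : ∀ p ∈ D, p.1 ∈ S)
    (Y : Multiset V) (hY : ∀ y ∈ Y, y ∈ S) (h : (D.map Prod.snd).sum < Y.card) :
    ∃ v, B.MonVal S D Y v := by
  induction D using Multiset.induction_on generalizing Y with
  | empty =>
    induction Y using Multiset.induction_on with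
    | empty => simp at h
    | cons y W ih =>
      have hy := hY y (Multiset.mem_cons_self _ _)
      by_cases hW : W = 0
      · subst hW
        exact ⟨y, .letter hy⟩
      · obtain ⟨v, hv⟩ := ih (fun u hu => hY u (Multiset.mem_cons_of_mem hu))
          (by simpa using Multiset.card_pos.2 hW)
        exact ⟨_, .mul hy hv⟩
  | cons p D ih =>
    obtain ⟨x, s⟩ := p
    rw [Multiset.map_cons, Multiset.sum_cons] at h
    -- Any `s` letters may be given to this operator; the strict inequality survives for the rest.
    obtain ⟨Z, W, hZ, rfl⟩ : ∃ Z W : Multiset V, Z.card = s ∧ Y = Z + W := by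
      obtain ⟨l, rfl⟩ := Quotient.exists_rep Y
      refine ⟨↑(l.take s), ↑(l.drop s), ?_, ?_⟩
      · rw [Multiset.quot_mk_to_coe, Multiset.coe_card] at h
        rw [Multiset.coe_card, List.length_take]
        omega
      · rw [Multiset.quot_mk_to_coe, Multiset.coe_add, List.take_append_drop]
    obtain ⟨v, hv⟩ := ih (fun q hq => hD q (Multiset.mem_cons_of_mem hq)) W
      (fun u hu => hY u (Multiset.mem_add.2 (Or.inr hu)))
      (by rw [Multiset.card_add] at h; omega)
    exact ⟨_, .op (hD (x, s) (Multiset.mem_cons_self _ _))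
      (fun u hu => hY u (Multiset.mem_add.2 (Or.inl hu))) hZ hv⟩

/-- The case of `op` is `derivOp_succ` read backwards, as a formula for `B.star (B.derivOp x s Z
v)`. -/
theorem star_mem (hB : B.IsGDDual) (h : B.MonVal S D Y v) : B.star v ∈ B.letterAlg S := by
  classical
  have hstar : ∀ y ∈ S, B.star y ∈ B.letterAlg S := fun y hy =>
    B.derivOp_mem_letterAlg hy (Z := 0) (s := 0) (by simp) rfl
  induction h with
  | letter hy => exact hstar _ hy
  | @mul D Y y v hy h ih =>
    have : B.star (B.ast y v) = B.star y * B.ast v + B.star v * B.ast y := by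
      ext z; exact (hB.ast_star _ _ _).symm
    rw [this]
    exact add_mem (mul_mem (hstar y hy) (h.ast_mem hB)) (mul_mem ih (B.ast_mem_letterAlg hy))
  | @op D Y Z x v s hx hZ hs h ih =>
    -- As `v` need not be a letter, it is written as `T y` with a letter `y`, and `T` is pulled out.
    have aux : ∀ (s : ℕ) (W : Multiset V), (∀ z ∈ W, z ∈ S) → W.card + 1 = s →
        B.derivOp x s (v ::ₘ W) ∈ B.letterAlg S := by
      intro s W hW hs
      obtain ⟨y, hy, hyS⟩ := h.exists_mem
      obtain ⟨Y, rfl⟩ := Multiset.exists_cons_of_mem hy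
      obtain ⟨T, hT, rfl, -⟩ := h.exchange hB rfl
      rw [hB.derivOp_apply_cons x y hs (B.letterAlg_le_multAlg S hT)]
      refine mul_mem hT (B.derivOp_mem_letterAlg hx ?_ (by simpa using hs))
      intro z hz
      rcases Multiset.mem_cons.1 hz with rfl | hz
      exacts [hyS, hW z hz]
    have e := hB.derivOp_succ x v hs
    rw [sub_sub, eq_sub_iff_add_eq] at e
    rw [← e]
    refine add_mem (aux _ _ hZ (by rw [hs])) (add_mem
      (mul_mem ih (B.derivOp_mem_letterAlg hx hZ hs)) (multiset_sum_mem _ ?_))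
    intro T hT
    obtain ⟨u, hu, rfl⟩ := Multiset.mem_map.1 hT
    exact mul_mem (hstar u (hZ u hu)) (aux _ _ (fun z hz => hZ z (Multiset.mem_of_mem_erase hz))
      (by rw [Multiset.card_erase_add_one hu, hs]))

end MonVal

/-- The span of the values of monomials is closed under both operations. -/
theorem IsGDDual.span_monVal {B : BiAlg K V} (hB : B.IsGDDual) (S : Set V) {a b : V}
    (ha : a ∈ Submodule.span K {v | ∃ D Y, B.MonVal S D Y v})
    (hb : b ∈ Submodule.span K {v | ∃ D Y, B.MonVal S D Y v}) :
    B.ast a b ∈ Submodule.span K {v | ∃ D Y, B.MonVal S D Y v} ∧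
      B.star a b ∈ Submodule.span K {v | ∃ D Y, B.MonVal S D Y v} := by
  have key : ∀ T ∈ B.letterAlg S, ∀ b ∈ Submodule.span K {v | ∃ D Y, B.MonVal S D Y v},
      T b ∈ Submodule.span K {v | ∃ D Y, B.MonVal S D Y v} := by
    intro T hT
    induction hT using Algebra.adjoin_induction with
    | mem T hT =>
      intro b hb
      induction hb using Submodule.span_induction with
      | mem b hb =>
        obtain ⟨D, Y, hb⟩ := hb
        rcases hT with ⟨y, hy, rfl⟩ | ⟨x, hx, Z, hZ, rfl⟩
        · exact Submodule.subset_span ⟨_, _, .mul hy hb⟩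
        · exact Submodule.subset_span ⟨_, _, .op hx hZ rfl hb⟩
      | zero => rw [map_zero]; exact zero_mem _
      | add b c _ _ hb hc => rw [map_add]; exact add_mem hb hc
      | smul r b _ hb => rw [map_smul]; exact Submodule.smul_mem _ _ hb
    | algebraMap c =>
      intro b hb
      exact Submodule.smul_mem _ _ hb
    | add T T' _ _ h h' => exact fun b hb => add_mem (h b hb) (h' b hb)
    | mul T T' _ _ h h' => exact fun b hb => h _ (h' b hb)
  induction ha using Submodule.span_induction with
  | mem a ha =>
    obtain ⟨D, Y, ha⟩ := ha
    exact ⟨key _ (ha.ast_mem hB) b hb, key _ (ha.star_mem hB) b hb⟩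
  | zero => simp only [map_zero, LinearMap.zero_apply]; exact ⟨zero_mem _, zero_mem _⟩
  | add a c _ _ ha hc =>
    simp only [map_add, LinearMap.add_apply]
    exact ⟨add_mem ha.1 hc.1, add_mem ha.2 hc.2⟩
  | smul r a _ ha =>
    simp only [map_smul, LinearMap.smul_apply]
    exact ⟨Submodule.smul_mem _ _ ha.1, Submodule.smul_mem _ _ ha.2⟩

end BiAlg

/-! ### Evaluation of the values in differential algebras. -/

theorem Derivation.map_multiset_prod {K : Type u} [Field K] {P : Type w} [CommRing P] [Algebra K P]
    (δ : Derivation K P P) {ι : Type t} [DecidableEq ι] (f : ι → P) (Z : Multiset ι) :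
    δ (Z.map f).prod = (Z.map fun u => δ (f u) * ((Z.erase u).map f).prod).sum := by
  induction Z using Multiset.induction_on with
  | empty => simp
  | cons y Z ih =>
    have e : (Z.map fun u => δ (f u) * (((y ::ₘ Z).erase u).map f).prod).sum =
        f y * (Z.map fun u => δ (f u) * ((Z.erase u).map f).prod).sum := by
      rw [← Multiset.sum_map_mul_left]
      congr 1
      refine Multiset.map_congr rfl fun u hu => ?_
      rw [Multiset.erase_cons_tail_of_mem hu, Multiset.map_cons, Multiset.prod_cons]
      ring
    rw [Multiset.map_cons, Multiset.prod_cons, Derivation.leibniz, Multiset.map_cons,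
      Multiset.sum_cons, e, ih, Multiset.erase_cons_head, smul_eq_mul, smul_eq_mul]
    ring

namespace BiAlg

variable {K : Type u} [Field K] {V : Type v} [AddCommGroup V] [Module K V]

section ToDifferential

variable {B : BiAlg K V} {P : Type w} [CommRing P] [Algebra K P] {δ : Derivation K P P}
  {f : V →ₗ[K] P}

theorem IsGDDual.map_derivOp (hB : B.IsGDDual)
    (hstar : ∀ x y, f (B.star x y) = δ (f x) * f y) (x : V) {s : ℕ} {Z : Multiset V}
    (hZ : Z.card = s) (v : V) :
    f (B.derivOp x s Z v) = δ^[s + 1] (f x) * (Z.map f).prod * f v := by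
  classical
  induction s generalizing Z v with
  | zero =>
    obtain rfl := Multiset.card_eq_zero.1 hZ
    simp [derivOp, hstar]
  | succ s ih =>
    obtain ⟨y, hy⟩ := Multiset.card_pos_iff_exists_mem.1 (by omega : 0 < Z.card)
    obtain ⟨Z, rfl⟩ := Multiset.exists_cons_of_mem hy
    have hZ' : Z.card = s := by simpa using hZ
    -- Together with the `star y` term, these are the Leibniz terms subtracted in the recursion: `d`
    -- applied to the product of `Z`.
    have hsum : f ((Z.map fun u => B.star u * B.derivOp x s (y ::ₘ Z.erase u)).sum v) =
        δ^[s + 1] (f x) * δ (Z.map f).prod * f y * f v := by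
      have e : ∀ M : Multiset (Module.End K V), f (M.sum v) = (M.map fun T => f (T v)).sum := by
        intro M
        induction M using Multiset.induction_on with
        | empty => simp
        | cons T M ihM => simp [ihM]
      rw [e, Multiset.map_map, Derivation.map_multiset_prod, ← Multiset.sum_map_mul_left,
        ← Multiset.sum_map_mul_right, ← Multiset.sum_map_mul_right]
      congr 1
      refine Multiset.map_congr rfl fun u hu => ?_
      rw [Function.comp_apply, Module.End.mul_apply, hstar, ih (by rw [Multiset.card_cons, Multiset.card_erase_add_one hu, hZ']),
        Multiset.map_cons, Multiset.prod_cons]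
      ring
    rw [hB.derivOp_succ x y hZ', LinearMap.sub_apply, LinearMap.sub_apply, map_sub, map_sub, hsum,
      hstar, Module.End.mul_apply, hstar, ih hZ', ih hZ', Derivation.leibniz, Derivation.leibniz,
      Multiset.map_cons, Multiset.prod_cons, Function.iterate_succ_apply' _ (s + 1)]
    simp only [smul_eq_mul]
    ring

theorem MonVal.map_eq (hB : B.IsGDDual) (hast : ∀ x y, f (B.ast x y) = f x * f y)
    (hstar : ∀ x y, f (B.star x y) = δ (f x) * f y) {S : Set V} {D : Multiset (V × ℕ)}
    {Y : Multiset V} {v : V} (h : B.MonVal S D Y v) :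
    f v = (D.map fun p => δ^[p.2 + 1] (f p.1)).prod * (Y.map f).prod := by
  induction h with
  | letter => simp
  | mul hy h ih =>
    rw [hast, ih, Multiset.map_cons, Multiset.prod_cons]
    ring
  | op hx hZ hs h ih =>
    rw [hB.map_derivOp hstar _ hs, ih, Multiset.map_cons, Multiset.prod_cons,
      Multiset.map_add, Multiset.prod_add]
    ring

end ToDifferential

/-- The converse of `exists_val`: only monomials of weight ≤ -1 have values. -/
theorem MonVal.sum_lt_card {B : BiAlg K V} {S : Set V} {D : Multiset (V × ℕ)} {Y : Multiset V}
    {v : V} (h : B.MonVal S D Y v) : (D.map Prod.snd).sum < Y.card := by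
  induction h with
  | letter => simp
  | mul hy h ih => rw [Multiset.card_cons]; omega
  | op hx hZ hs h ih =>
    rw [Multiset.map_cons, Multiset.sum_cons, Multiset.card_add]
    omega

/-- The letters of a value can be taken from any family with range `S`. -/
theorem MonVal.exists_map {B : BiAlg K V} {X : Type w} {a : X → V} {D : Multiset (V × ℕ)}
    {Y : Multiset V} {v : V} (h : B.MonVal (Set.range a) D Y v) :
    ∃ (D' : Multiset (X × ℕ)) (Y' : Multiset X), D = D'.map (Prod.map a id) ∧ Y = Y'.map a := by
  induction h with
  | letter hy =>
    obtain ⟨x, rfl⟩ := hy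
    exact ⟨0, {x}, rfl, rfl⟩
  | mul hy h ih =>
    obtain ⟨x, rfl⟩ := hy
    obtain ⟨D', Y', rfl, rfl⟩ := ih
    exact ⟨D', x ::ₘ Y', rfl, (Multiset.map_cons _ _ _).symm⟩
  | @op D Y Z x v s hx hZ hs h ih =>
    obtain ⟨x, rfl⟩ := hx
    obtain ⟨D', Y', rfl, rfl⟩ := ih
    obtain ⟨Z', rfl⟩ : ∃ Z' : Multiset X, Z = Z'.map a := by
      clear hs
      induction Z using Multiset.induction_on with
      | empty => exact ⟨0, rfl⟩
      | cons z Z ih =>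
        obtain ⟨Z', rfl⟩ := ih fun u hu => hZ u (Multiset.mem_cons_of_mem hu)
        obtain ⟨z, rfl⟩ := hZ z (Multiset.mem_cons_self _ _)
        exact ⟨z ::ₘ Z', (Multiset.map_cons _ _ _).symm⟩
    exact ⟨(x, s) ::ₘ D', Z' + Y', by simp, (Multiset.map_add _ _ _).symm⟩

end BiAlg

/-! ### Monomials as multisets of factors, and their weights. -/

namespace ComDer

variable {X : Type w}

/-- The multiset of factors `d^(s+1)(x)`, `(x, s) ∈ D`, and `x`, `x ∈ Y`. -/
def factors (D : Multiset (X × ℕ)) (Y : Multiset X) : Multiset (X × ℕ) :=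
  D.map (fun p => (p.1, p.2 + 1)) + Y.map fun x => (x, 0)

theorem factors_injective {D D' : Multiset (X × ℕ)} {Y Y' : Multiset X}
    (h : factors D Y = factors D' Y') : D = D' ∧ Y = Y' := by
  have hnone : ∀ {α β : Type w} (M : Multiset α), M.filterMap (fun _ => (none : Option β)) = 0 := by
    intro α β M
    induction M using Multiset.induction_on with
    | empty => rfl
    | cons a M ih => rw [Multiset.filterMap_cons_none _ _ rfl, ih]
  constructor
  · have := congrArg (Multiset.filterMap fun p : X × ℕ =>
      if p.2 = 0 then none else some (p.1, p.2 - 1)) h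
    simpa [factors, Multiset.filterMap_map, Multiset.filterMap_add, Function.comp_def, hnone] using this
  · have := congrArg (Multiset.filterMap fun p : X × ℕ => if p.2 = 0 then some p.1 else none) h
    simpa [factors, Multiset.filterMap_map, Multiset.filterMap_add, Function.comp_def, hnone] using this

theorem exists_factors (M : Multiset (X × ℕ)) : ∃ D Y, M = factors D Y := by
  induction M using Multiset.induction_on with
  | empty => exact ⟨0, 0, rfl⟩
  | cons p M ih =>
    obtain ⟨D, Y, rfl⟩ := ih
    obtain ⟨x, s⟩ := p
    cases s with
    | zero => exact ⟨D, x ::ₘ Y, by simp [factors]⟩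
    | succ s => exact ⟨(x, s) ::ₘ D, Y, by simp [factors]⟩

theorem wt_add (m n : (X × ℕ) →₀ ℕ) : wt (m + n) = wt m + wt n :=
  Finsupp.sum_add_index' (by simp) fun _ _ _ => by push_cast; ring

theorem wt_toFinsupp [DecidableEq (X × ℕ)] (M : Multiset (X × ℕ)) :
    wt M.toFinsupp = (M.map fun p => (p.2 : ℤ) - 1).sum := by
  induction M using Multiset.induction_on with
  | empty => simp [wt]
  | cons p M ih =>
    rw [← Multiset.singleton_add, Multiset.toFinsupp_add, wt_add, ih, Multiset.toFinsupp_singleton,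
      Multiset.map_add, Multiset.sum_add]
    simp [wt]

/-- Weight ≤ -1 thus becomes the inequality of `exists_val` and `sum_lt_card`. -/
theorem wt_factors [DecidableEq (X × ℕ)] (D : Multiset (X × ℕ)) (Y : Multiset X) :
    wt (factors D Y).toFinsupp = ((D.map Prod.snd).sum : ℕ) - (Y.card : ℤ) := by
  rw [wt_toFinsupp, factors, Multiset.map_add, Multiset.sum_add, Multiset.map_map,
    Multiset.map_map]
  simp [Multiset.map_map, sub_eq_add_neg]

theorem prod_map_X [DecidableEq (X × ℕ)] (K : Type u) [Field K] (M : Multiset (X × ℕ)) :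
    (M.map (MvPolynomial.X (R := K))).prod = MvPolynomial.monomial M.toFinsupp 1 := by
  induction M using Multiset.induction_on with
  | empty => simp
  | cons p M ih =>
    rw [Multiset.map_cons, Multiset.prod_cons, ih, ← Multiset.singleton_add,
      Multiset.toFinsupp_add, Multiset.toFinsupp_singleton, MvPolynomial.X,
      MvPolynomial.monomial_mul, mul_one]

theorem linearIndependent_monomial (K : Type u) [Field K] {σ : Type w} (p : (σ →₀ ℕ) → Prop) :
    LinearIndependent K fun m : {m // p m} => MvPolynomial.monomial m.1 (1 : K) := by
  have h := (MvPolynomial.basisMonomials σ K).linearIndependent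
  rw [MvPolynomial.coe_basisMonomials] at h
  exact h.comp (Subtype.val : {m // p m} → σ →₀ ℕ) Subtype.val_injective

theorem polyD_iterate (K : Type u) [Field K] (x : X) (s : ℕ) :
    (polyD K X)^[s] (MvPolynomial.X (x, 0)) = MvPolynomial.X (x, s) := by
  induction s with
  | zero => rfl
  | succ s ih =>
    rw [Function.iterate_succ_apply', ih, polyD, MvPolynomial.mkDerivation_X]

end ComDer

/-! ### The monomial basis of the free algebra. -/

namespace FreeGDDual

variable (K : Type u) [Field K] {X : Type w}

/-- The canonical homomorphism to differential polynomials. -/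
noncomputable def toPoly (X : Type w) : FreeGDDual K X →ₗ[K] MvPolynomial (X × ℕ) K :=
  (NonUnitalSubalgebra.toSubmodule (ComDer K X)).subtype ∘ₗ toComDer K X

theorem toComDer_isHom (X : Type w) : (alg K X).IsHom (derAlg (ComDer.d K X)) (toComDer K X) :=
  lift_isHom _ _ _

theorem toPoly_ast (f g : FreeGDDual K X) :
    toPoly K X ((alg K X).ast f g) = toPoly K X f * toPoly K X g :=
  congrArg Subtype.val ((toComDer_isHom K X).1 f g)

theorem toPoly_star (f g : FreeGDDual K X) :
    toPoly K X ((alg K X).star f g) = ComDer.polyD K X (toPoly K X f) * toPoly K X g :=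
  congrArg Subtype.val ((toComDer_isHom K X).2 f g)

theorem toPoly_of (x : X) : toPoly K X (of K x) = MvPolynomial.X (x, 0) :=
  congrArg Subtype.val (lift_of _ _ _ x)

theorem toPoly_monVal [DecidableEq (X × ℕ)] {S : Set (FreeGDDual K X)} {D : Multiset (X × ℕ)}
    {Y : Multiset X} {v : FreeGDDual K X}
    (h : (alg K X).MonVal S (D.map (Prod.map (of K) id)) (Y.map (of K)) v) :
    toPoly K X v = MvPolynomial.monomial (ComDer.factors D Y).toFinsupp 1 := by
  rw [h.map_eq (alg_isGDDual K X) (toPoly_ast K) (toPoly_star K), ← ComDer.prod_map_X,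
    ComDer.factors, Multiset.map_add, Multiset.prod_add]
  simp only [Multiset.map_map, Function.comp_def, Prod.map_fst, Prod.map_snd, id_eq, toPoly_of,
    ComDer.polyD_iterate]

theorem span_monVal_eq_top :
    Submodule.span K {v | ∃ D Y, (alg K X).MonVal (Set.range (of K)) D Y v} = ⊤ := by
  have hB := alg_isGDDual K X
  have surj := (BiPoly.gdTIdeal K X).mkQ_surjective
  have key : ∀ s : BiWord X, (BiPoly.gdTIdeal K X).mkQ (Finsupp.single s 1) ∈
      Submodule.span K {v | ∃ D Y, (alg K X).MonVal (Set.range (of K)) D Y v} := by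
    intro s
    induction s with
    | var x => exact Submodule.subset_span ⟨_, _, .letter ⟨x, rfl⟩⟩
    | ast s r hs hr =>
      have := (hB.span_monVal _ hs hr).1
      simpa [alg, BiAlg.quot, -Submodule.mkQ_apply, BiPoly.alg] using this
    | star s r hs hr =>
      have := (hB.span_monVal _ hs hr).2
      simpa [alg, BiAlg.quot, -Submodule.mkQ_apply, BiPoly.alg] using this
  rw [eq_top_iff]
  rintro f -
  obtain ⟨f, rfl⟩ := surj f
  induction f using Finsupp.induction_linear with
  | zero => rw [map_zero]; exact zero_mem _
  | add f g hf hg => rw [map_add]; exact add_mem hf hg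
  | single s c =>
    rw [← mul_one c, ← smul_eq_mul, ← Finsupp.smul_single, map_smul]
    exact Submodule.smul_mem _ _ (key s)

variable (X) in
theorem exists_basis : ∃ b : Basis {m : (X × ℕ) →₀ ℕ // ComDer.wt m ≤ -1} K (FreeGDDual K X),
    ∀ m, toPoly K X (b m) = MvPolynomial.monomial m.1 1 := by
  classical
  have hB := alg_isGDDual K X
  have hex : ∀ m : {m : (X × ℕ) →₀ ℕ // ComDer.wt m ≤ -1}, ∃ v : FreeGDDual K X,
      ∃ D Y, m.1 = (ComDer.factors D Y).toFinsupp ∧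
        (alg K X).MonVal (Set.range (of K)) (D.map (Prod.map (of K) id)) (Y.map (of K)) v := by
    rintro ⟨m, hm⟩
    obtain ⟨D, Y, h⟩ := ComDer.exists_factors m.toMultiset
    obtain rfl : m = (ComDer.factors D Y).toFinsupp := by
      rw [← h, Finsupp.toMultiset_toFinsupp]
    rw [ComDer.wt_factors] at hm
    obtain ⟨v, hv⟩ := BiAlg.MonVal.exists_val (alg K X) (S := Set.range (of K))
      (D.map (Prod.map (of K) id))
      (by
        intro p hp
        obtain ⟨q, -, rfl⟩ := Multiset.mem_map.1 hp
        exact ⟨q.1, rfl⟩)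
      (Y.map (of K)) (by simp)
      (by
        rw [Multiset.map_map, Multiset.card_map]
        change (D.map Prod.snd).sum < _
        omega)
    exact ⟨v, D, Y, rfl, hv⟩
  choose b hb using hex
  have hpoly : ∀ m, toPoly K X (b m) = MvPolynomial.monomial m.1 1 := by
    intro m
    obtain ⟨D, Y, hm, hv⟩ := hb m
    rw [hm, toPoly_monVal K hv]
  have hli : LinearIndependent K b := by
    refine LinearIndependent.of_comp (toPoly K X) ?_
    rw [show toPoly K X ∘ b = fun m => MvPolynomial.monomial m.1 1 from funext hpoly]
    exact ComDer.linearIndependent_monomial K _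
  have hspan : ⊤ ≤ Submodule.span K (Set.range b) := by
    rw [← span_monVal_eq_top, Submodule.span_le]
    rintro v ⟨D, Y, hv⟩
    obtain ⟨D, Y, rfl, rfl⟩ := hv.exists_map
    refine Submodule.subset_span ?_
    have hm : ComDer.wt (ComDer.factors D Y).toFinsupp ≤ -1 := by
      have := hv.sum_lt_card
      rw [Multiset.map_map, Multiset.card_map] at this
      change (D.map Prod.snd).sum < _ at this
      rw [ComDer.wt_factors]
      omega
    refine ⟨⟨_, hm⟩, ?_⟩
    -- The chosen vector is a value for some `D'`, `Y'` with the same factors, hence for the same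
    -- `D`, `Y`; uniqueness identifies it with `v`.
    obtain ⟨D', Y', h, hv'⟩ := hb ⟨_, hm⟩
    obtain ⟨rfl, rfl⟩ := ComDer.factors_injective (Multiset.toFinsupp.injective h)
    exact hv'.unique hB hv
  exact ⟨Basis.mk hli hspan, fun m => by rw [Basis.mk_apply, hpoly]⟩

variable (X) in
theorem toComDer_injective : Function.Injective (toComDer K X) := by
  obtain ⟨b, hb⟩ := exists_basis K X
  have hli : LinearIndependent K (toPoly K X ∘ b) := by
    rw [show toPoly K X ∘ b = fun m => MvPolynomial.monomial m.1 1 from funext hb]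
    exact ComDer.linearIndependent_monomial K _
  have hker : LinearMap.ker (toPoly K X) = ⊥ := by
    rw [LinearMap.ker_eq_bot']
    intro f hf
    rw [← b.linearCombination_repr f, Finsupp.apply_linearCombination] at hf
    exact b.repr.map_eq_zero_iff.1 (linearIndependent_iff.1 hli _ hf)
  exact fun f g h => LinearMap.ker_eq_bot.1 hker (congrArg Subtype.val h)

end FreeGDDual

/-! ### Identities and homomorphic images of special algebras. -/

theorem BiPoly.eval_map {K : Type u} [Field K] {X : Type w} {V : Type v} [AddCommGroup V]
    [Module K V] {W : Type t} [AddCommGroup W] [Module K W] {B : BiAlg K V} {C : BiAlg K W}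
    {h : V →ₗ[K] W} (hh : B.IsHom C h) (a : X → V) (f : BiPoly K X) :
    BiPoly.eval C (fun x => h (a x)) f = h (BiPoly.eval B a f) := by
  have key : ∀ s : BiWord X, s.eval C (fun x => h (a x)) = h (s.eval B a) := by
    intro s
    induction s with
    | var x => rfl
    | ast s r hs hr => simp only [BiWord.eval, hs, hr, hh.1]
    | star s r hs hr => simp only [BiWord.eval, hs, hr, hh.2]
  rw [BiPoly.eval, BiPoly.eval, Finsupp.apply_linearCombination]
  congr 2
  ext1 s
  exact key s

/-- Vanishing at the free generators is therefore membership in the T-ideal. -/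
theorem BiPoly.eval_of {K : Type u} [Field K] {X : Type w} (f : BiPoly K X) :
    BiPoly.eval (FreeGDDual.alg K X) (FreeGDDual.of K) f = (BiPoly.gdTIdeal K X).mkQ f := by
  have h : (BiPoly.alg K X).IsHom (FreeGDDual.alg K X) (BiPoly.gdTIdeal K X).mkQ :=
    ⟨fun _ _ => rfl, fun _ _ => rfl⟩
  have e : ∀ s : BiWord X, s.eval (BiPoly.alg K X) (fun x => Finsupp.single (.var x) 1) =
      Finsupp.single s 1 := by
    intro s
    induction s with
    | var x => rfl
    | ast s r hs hr => rw [BiWord.eval, hs, hr]; simp [BiPoly.alg]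
    | star s r hs hr => rw [BiWord.eval, hs, hr]; simp [BiPoly.alg]
  refine (BiPoly.eval_map h (fun x => Finsupp.single (.var x) 1) f).trans (congrArg _ ?_)
  rw [BiPoly.eval, funext e, Finsupp.linearCombination_apply]
  simp

theorem BiPoly.satisfies_of_mem {K : Type u} [Field K] {X : Type w} {V : Type v} [AddCommGroup V]
    [Module K V] {B : BiAlg K V} (hB : B.IsGDDual) {f : BiPoly K X}
    (hf : f ∈ BiPoly.gdTIdeal K X) : B.Satisfies f :=
  fun a => BiAlg.gdIdeal_le_ker hB (BiPoly.eval_isHom B a) hf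

theorem BiPoly.IsDerIdentity.mem {K : Type u} [Field K] {X : Type w} {f : BiPoly K X}
    (hf : BiPoly.IsDerIdentity.{u, w, max u w t} f) : f ∈ BiPoly.gdTIdeal K X := by
  -- One test suffices: the generators of the free differential algebra. `ULift` only adjusts the
  -- universe and is undone below by `lift`.
  have h := hf (ComDer K (ULift.{t} X)) (ComDer.d K _) (ComDer.d_isDer K _)
    fun x => FreeGDDual.toComDer K (ULift.{t} X) (FreeGDDual.of K ⟨x⟩)
  rw [BiPoly.eval_map (FreeGDDual.toComDer_isHom K _)] at h
  have h0 := FreeGDDual.toComDer_injective K _ (h.trans (map_zero _).symm)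
  have hX := FreeGDDual.alg_isGDDual K X
  have h1 := BiPoly.eval_map (FreeGDDual.lift_isHom _ hX fun x : ULift.{t} X =>
    FreeGDDual.of K x.down) (fun x : X => FreeGDDual.of K (ULift.up.{t} x)) f
  simp only [FreeGDDual.lift_of] at h1
  rw [h0, map_zero] at h1
  have h2 := (BiPoly.eval_of f).symm.trans h1
  rwa [Submodule.mkQ_apply, Submodule.Quotient.mk_eq_zero] at h2

namespace BiAlg

variable {K : Type u} [Field K] {V : Type v} [AddCommGroup V] [Module K V]
  {W : Type w} [AddCommGroup W] [Module K W]

theorem IsGDDual.of_injective {B : BiAlg K V} {C : BiAlg K W} (hC : C.IsGDDual) {j : V →ₗ[K] W}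
    (hj : B.IsHom C j) (inj : Function.Injective j) : B.IsGDDual := by
  obtain ⟨h1, h2⟩ := hj
  constructor <;> intros <;> apply inj <;> simp only [map_sub, map_add, h1, h2]
  · exact hC.ast_comm _ _
  · exact hC.ast_assoc _ _ _
  · exact hC.right_symm _ _ _
  · exact hC.left_comm _ _ _
  · exact hC.star_ast _ _ _
  · exact hC.ast_star _ _ _

theorem IsGDDual.of_surjective {B : BiAlg K V} {C : BiAlg K W} (hB : B.IsGDDual) {p : V →ₗ[K] W}
    (hp : B.IsHom C p) (surj : Function.Surjective p) : C.IsGDDual := by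
  obtain ⟨h1, h2⟩ := hp
  constructor
  · intro x y
    obtain ⟨x, rfl⟩ := surj x
    obtain ⟨y, rfl⟩ := surj y
    simp only [← h1, hB.ast_comm x y]
  all_goals
    intro x y z
    obtain ⟨x, rfl⟩ := surj x
    obtain ⟨y, rfl⟩ := surj y
    obtain ⟨z, rfl⟩ := surj z
    simp only [← h1, ← h2, ← map_sub, ← map_add]
    congr 1
  · exact hB.ast_assoc x y z
  · exact hB.right_symm x y z
  · exact hB.left_comm x y z
  · exact hB.star_ast x y z
  · exact hB.ast_star x y z

theorem IsSpecial.isGDDual {B : BiAlg K V} (hB : BiAlg.IsSpecial.{u, v, t} B) : B.IsGDDual := by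
  obtain ⟨A, _, _, _, _, d, j, hd, hj, inj⟩ := hB
  exact (derAlg_isGDDual hd).of_injective hj inj

theorem isImageOfSpecial_iff (B : BiAlg K V) :
    BiAlg.IsImageOfSpecial.{u, v, max u v t} B ↔ B.IsGDDual := by
  constructor
  · rintro ⟨S, _, _, C, p, hC, hp, surj⟩
    exact hC.isGDDual.of_surjective hp surj
  · intro hB
    -- The free algebra on all elements of `V` maps onto `V`, and it is special by
    -- `toComDer_injective`.
    refine ⟨FreeGDDual K (ULift.{t} V), inferInstance, inferInstance, FreeGDDual.alg K _,
      FreeGDDual.lift B hB ULift.down, ?_, FreeGDDual.lift_isHom _ _ _, fun v =>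
        ⟨FreeGDDual.of K ⟨v⟩, FreeGDDual.lift_of _ _ _ _⟩⟩
    exact ⟨ComDer K (ULift.{t} V), inferInstance, inferInstance, inferInstance, inferInstance,
      ComDer.d K _, FreeGDDual.toComDer K _, ComDer.d_isDer K _, FreeGDDual.toComDer_isHom K _,
      FreeGDDual.toComDer_injective K _⟩

end BiAlg

theorem mainTheorem6 (K : Type u) [Field K] :
    (∀ (V : Type v) [AddCommGroup V] [Module K V] (B : BiAlg K V),
      BiAlg.IsImageOfSpecial.{u, v, max u v t} B ↔ B.IsGDDual) ∧
    (∀ (X : Type w) (f : BiPoly K X),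
      (BiPoly.IsDerIdentity.{u, w, max u w t} f ↔ f ∈ BiPoly.gdTIdeal K X) ∧
      (BiPoly.IsDerIdentity.{u, w, max u w t} f ↔
        BiPoly.IsGDDualIdentity.{u, w, max u w t} f)) ∧
    (∀ X : Type w,
      ∃ b : Basis {m : (X × ℕ) →₀ ℕ // ComDer.wt m ≤ -1} K (FreeGDDual K X),
        ∀ m, (FreeGDDual.toComDer K X (b m) : MvPolynomial (X × ℕ) K) =
          MvPolynomial.monomial m.1 1) := by
  refine ⟨fun V _ _ B => BiAlg.isImageOfSpecial_iff.{u, v, t} B, fun X f => ⟨⟨fun h => BiPoly.IsDerIdentity.mem.{u, w, t} h, ?_⟩,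
    ⟨fun h V _ _ B hB => BiPoly.satisfies_of_mem hB (BiPoly.IsDerIdentity.mem.{u, w, t} h), ?_⟩⟩, fun X =>
      FreeGDDual.exists_basis K X⟩
  · intro hf A _ _ _ _ d hd
    exact BiPoly.satisfies_of_mem (derAlg_isGDDual hd) hf
  · intro h A _ _ _ _ d hd
    exact h A _ (derAlg_isGDDual hd)
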